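/- Let $G=(V,E)$ be a finite tree, and choose an orientation of each of its edges. Let $\mathcal A_G$ be the automaton with alphabet $V$ whose states are the oriented edges of $G$ together with a state $\mathrm{id}$. A state acts on words over $V$ as follows: $\mathrm{id}$ fixes every word, and for $e=(x,y)$ and a word $zw$ with first letter $z$, $$e(xw)=y\,e(w),\qquad e(yw)=xw,\qquad e(zw)=zw\quad (z\neq x,y),$$ and $e$ fixes the empty word. For $n\ge 0$ let $\Gamma_n^G$ be the $n$-th Schreier graph of $\mathcal A_G$, i.e. the undirected multigraph (with loops and parallel edges) with vertex set $V^n$ and with one edge $\{u,q(u)\}$ for every state $q$ and every $u\in V^n$. For a finite connected multigraph $\Gamma$ with distance $d$ let $$W(\Gamma)=\tfrac12\sum_{u,v\in V(\Gamma)} d(u,v),\qquad \mathrm{Sz}(\Gamma)=\sum_{e=\{u,v\}\in E(\Gamma)} n(u,v)\,n(v,u)$$ be its Wiener index (the sum of the distances over all unordered pairs of vertices) and its Szeged index, where $n(u,v)$ is the number of vertices of $\Gamma$ strictly closer to $u$ than to $v$, and parallel edges are counted with multiplicity. Then for every finite tree $G$, every choice of orientation of its edges and every $n\ge 0$, the graph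 $\Gamma_n^G$ is connected and $$\mathrm{Sz}(\Gamma_n^G)=2\,W(\Gamma_n^G).$$ -/

import Mathlib

/-! ### Finite multigraphs, Wiener index and Szeged index -/

/-- An undirected multigraph (loops and parallel edges allowed) with vertex set `V` and
edge set `E`: every edge has an unordered pair of end vertices. -/
structure Multigraph (V E : Type*) where
  /-- The unordered pair of end vertices of an edge. -/
  ends : E → Sym2 V

namespace Multigraph

variable {V E : Type*}

/-- The underlying simple graph: distinct vertices are adjacent if some edge joins them.
Dropping loops and identifying parallel edges does not change distances or connectedness. -/
def simplify (Γ : Multigraph V E) : SimpleGraph V where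
  Adj u v := u ≠ v ∧ ∃ e, Γ.ends e = s(u, v)
  symm := ⟨fun _ _ h => ⟨h.1.symm, h.2.imp fun _ he => he.trans Sym2.eq_swap⟩⟩
  loopless := ⟨fun _ h => h.1 rfl⟩

/-- A multigraph is connected if it has a vertex and any two vertices are joined by a path. -/
def Connected (Γ : Multigraph V E) : Prop := Γ.simplify.Connected

/-- The distance of two vertices: the length of a shortest path joining them. -/
noncomputable def dist (Γ : Multigraph V E) (u v : V) : ℕ := Γ.simplify.dist u v

/-- The total distance from `v`: the sum of the distances of all vertices from `v`. -/
noncomputable def totalDist [Fintype V] (Γ : Multigraph V E) (v : V) : ℕ := ∑ u, Γ.dist u v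

/-- The Wiener index: the sum of the distances of all unordered pairs of vertices, i.e. half the
sum of all total distances. -/
noncomputable def wiener [Fintype V] (Γ : Multigraph V E) : ℚ :=
  (1 / 2) * ∑ v, (Γ.totalDist v : ℚ)

/-- `n(u, v)`: the number of vertices strictly closer to `u` than to `v`. -/
noncomputable def numCloser [Fintype V] (Γ : Multigraph V E) (u v : V) : ℕ :=
  (Finset.univ.filter fun w => Γ.dist w u < Γ.dist w v).card

/-- The Szeged index: the sum of `n(u, v) * n(v, u)` over all edges `e` with ends `u`, `v`, where
parallel edges are counted with multiplicity (and loops contribute `0`). -/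
noncomputable def szeged [Fintype V] [Fintype E] (Γ : Multigraph V E) : ℕ :=
  ∑ e, Sym2.lift ⟨fun u v => Γ.numCloser u v * Γ.numCloser v u, fun _ _ => Nat.mul_comm _ _⟩
    (Γ.ends e)

end Multigraph

/-! ### Automata and their Schreier graphs -/

/-- An automaton (transducer) with set of states `Q` and alphabet `X`. -/
structure Transducer (Q X : Type*) where
  /-- The restriction map `λ`. -/
  restr : Q → X → Q
  /-- The output map `η`. -/
  out : Q → X → X

namespace Transducer

variable {Q X : Type*}

/-- The action of a state on words of length `n`:
`η(q, x w) = η(q, x) η(λ(q, x), w)` for a letter `x` and a word `w`. -/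
def act (A : Transducer Q X) : {n : ℕ} → Q → (Fin n → X) → (Fin n → X)
  | 0, _, w => w
  | _ + 1, q, w => Fin.cons (A.out q (w 0)) (A.act (A.restr q (w 0)) (Fin.tail w))

/-- The `n`-th Schreier graph: its vertices are the words of length `n`, and every state `q` and
word `u` give one edge (labelled `q`), which joins `u` and `η(q, u)`. -/
def schreierGraph (A : Transducer Q X) (n : ℕ) : Multigraph (Fin n → X) (Q × (Fin n → X)) where
  ends e := s(e.2, A.act e.1 e.2)

end Transducer

/-! ### The automaton of an oriented graph -/

/-- A choice of an orientation `(source e, target e)` of every edge `e` of `G`. -/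
structure SimpleGraph.EdgeOrientation {V : Type*} (G : SimpleGraph V) where
  /-- The first vertex of the oriented edge. -/
  source : G.edgeSet → V
  /-- The second vertex of the oriented edge. -/
  target : G.edgeSet → V
  ends_eq : ∀ e : G.edgeSet, s(source e, target e) = (e : Sym2 V)

/-- The graph automaton `A_G`: the alphabet is the vertex set of `G`, the states are the (oriented)
edges `some e` of `G` and the sink `none = id`. The state `e = (x, y)` exchanges the letters `x`
and `y`, fixes all other letters, has restriction `e` at `x` and restriction `id` elsewhere. -/
def SimpleGraph.EdgeOrientation.automaton {V : Type*} [DecidableEq V] {G : SimpleGraph V}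
    (o : G.EdgeOrientation) : Transducer (Option G.edgeSet) V where
  restr
    | none, _ => none
    | some e, z => if z = o.source e then some e else none
  out
    | none, z => z
    | some e, z => if z = o.source e then o.target e else if z = o.target e then o.source e else z

/-!
Each state permutes the words of length `n`, and `Γ_n` is a cactus glued from the cycles of these
permutations: the bipartite incidence graph of words and cycles is a tree, because it is connected
and a recursive count of the cycles shows that it has fewer edges than vertices. Every nontrivial
cycle is even, since it toggles the first letter between the ends of one edge of `G`.

An edge `{u, v}` with `u ≠ v` of a cactus of even cycles separates the vertices closer to `v` (its
far side) from those closer to `u`, according to which half of its cycle contains the gate of the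
vertex. The edge itself and the opposite edge of its cycle are the only edges whose far sides
change membership when it is traversed, so `d(a, b)` is the number of edges that have `b` but not
`a` on their far side. Summing over all ordered pairs `(a, b)` and exchanging the sums turns
`∑ d(a, b) = 2 W` into the sum of the products `n(u, v) n(v, u)`, which is the Szeged index.
-/

open Function Equiv.Perm

section Permutation

theorem even_minimalPeriod_of_flip {α : Type*} {f : α → α} (hf : Injective f) {P : α → Prop}
    (hflip : ∀ v, f v ≠ v → (P (f v) ↔ ¬P v)) {u : α} (hu : f u ≠ u) :
    Even (minimalPeriod f u) := by
  have hmoved (j : ℕ) : f (f^[j] u) ≠ f^[j] u := by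
    rw [← iterate_succ_apply' f, iterate_succ_apply]
    exact fun h => hu (hf.iterate j h)
  have hparity (j : ℕ) : P (f^[j] u) ↔ (P u ↔ Even j) := by
    induction j with
    | zero => simp
    | succ j ih => rw [iterate_succ_apply', hflip _ (hmoved j), ih, Nat.even_add_one]; tauto
  have hperiod := hparity (minimalPeriod f u)
  rw [iterate_minimalPeriod] at hperiod
  tauto

variable {X : Type*} {τ : Equiv.Perm X} {u v : X}

theorem minimalPeriod_iterate_perm [Finite X] (u : X) (i : ℕ) :
    minimalPeriod τ (τ^[i] u) = minimalPeriod τ u :=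
  minimalPeriod_apply_iterate (τ.injective.mem_periodicPts u) i

theorem sameCycle_iterate (u : X) (i : ℕ) : τ.SameCycle u (τ^[i] u) :=
  ⟨i, by rw [iterate_eq_pow, zpow_natCast]⟩

theorem exists_iterate_eq_of_sameCycle [Finite X] (h : τ.SameCycle u v) :
    ∃ j < minimalPeriod τ u, τ^[j] u = v := by
  obtain ⟨i, rfl⟩ := h.exists_nat_pow_eq
  have hpos := minimalPeriod_pos_of_mem_periodicPts (τ.injective.mem_periodicPts u)
  exact ⟨i % minimalPeriod τ u, Nat.mod_lt _ hpos, by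
    rw [iterate_mod_minimalPeriod_eq, iterate_eq_pow]⟩

/-- `v` lies in the half of the `τ`-cycle of `u` that begins right after `u`: it is one of
`τ u, τ² u, …, τᵐ u`, where the cycle has length `2m` (or `2m + 1`). If the length is even, these
are the points of the cycle which are closer to `τ u` than to `u` along the cycle. -/
def IsAhead (τ : Equiv.Perm X) (u v : X) : Prop :=
  ∃ j, 0 < j ∧ j ≤ minimalPeriod τ u / 2 ∧ τ^[j] u = v

/-- The point opposite to `u` in its `τ`-cycle, if that cycle has even length. -/
noncomputable def antipode (τ : Equiv.Perm X) (u : X) : X := τ^[minimalPeriod τ u / 2] u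

theorem isAhead_iterate_iff {j : ℕ} (hj : j < minimalPeriod τ u) :
    IsAhead τ u (τ^[j] u) ↔ 0 < j ∧ j ≤ minimalPeriod τ u / 2 := by
  refine ⟨?_, fun h => ⟨j, h.1, h.2, rfl⟩⟩
  rintro ⟨i, hi, hi', hij⟩
  obtain rfl := (iterate_eq_iterate_iff_of_lt_minimalPeriod (by omega) hj).1 hij
  exact ⟨hi, hi'⟩

theorem not_isAhead_self [Finite X] (u : X) : ¬IsAhead τ u u := by
  have hpos := minimalPeriod_pos_of_mem_periodicPts (τ.injective.mem_periodicPts u)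
  exact fun h => absurd ((isAhead_iterate_iff (j := 0) hpos).1 h).1 (lt_irrefl 0)

theorem not_isAhead_of_fixed (hu : τ u = u) : ¬IsAhead τ u v := by
  rintro ⟨j, hj, hj', -⟩
  rw [minimalPeriod_eq_one_iff_isFixedPt.2 hu] at hj'
  omega

theorem IsAhead.of_apply_ne [Finite X] (h : IsAhead τ u v) (hv : τ u ≠ v) :
    IsAhead τ (τ u) v := by
  obtain ⟨j, hj, hj', rfl⟩ := h
  obtain ⟨i, rfl⟩ := Nat.exists_eq_add_one.2 hj
  have hi : i ≠ 0 := by rintro rfl; exact hv rfl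
  refine ⟨i, Nat.pos_of_ne_zero hi, ?_, rfl⟩
  have hperiod : minimalPeriod τ (τ u) = minimalPeriod τ u := minimalPeriod_iterate_perm u 1
  omega

theorem isAhead_antipode_iff [Finite X] (heven : Even (minimalPeriod τ u))
    (huv : τ.SameCycle u v) : IsAhead τ (antipode τ u) v ↔ ¬IsAhead τ u v := by
  obtain ⟨j, hj, rfl⟩ := exists_iterate_eq_of_sameCycle huv
  have hhalf := Nat.two_mul_div_two_of_even heven
  have hperiod : minimalPeriod τ (antipode τ u) = minimalPeriod τ u :=
    minimalPeriod_iterate_perm u _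
  set m := minimalPeriod τ u / 2
  rw [isAhead_iterate_iff hj]
  rcases lt_or_ge j m with hjm | hmj
  · have hv : τ^[j] u = τ^[j + m] (antipode τ u) := by
      rw [antipode, ← iterate_add_apply, add_assoc, ← two_mul, hhalf, iterate_add_minimalPeriod_eq]
    rw [hv, isAhead_iterate_iff (by omega), hperiod]
    omega
  · have hv : τ^[j] u = τ^[j - m] (antipode τ u) := by
      rw [antipode, ← iterate_add_apply, Nat.sub_add_cancel hmj]
    rw [hv, isAhead_iterate_iff (by omega), hperiod]
    omega

theorem eq_antipode_iterate_iff [Finite X] (heven : Even (minimalPeriod τ u)) {j : ℕ}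
    (hj : j < minimalPeriod τ u) : u = antipode τ (τ^[j] u) ↔ j = minimalPeriod τ u / 2 := by
  have hhalf := Nat.two_mul_div_two_of_even heven
  rw [antipode, minimalPeriod_iterate_perm, ← iterate_add_apply, eq_comm]
  set m := minimalPeriod τ u / 2
  change IsPeriodicPt τ (m + j) u ↔ j = m
  rw [isPeriodicPt_iff_minimalPeriod_dvd]
  refine ⟨fun hdvd => ?_, fun h => ⟨1, by omega⟩⟩
  have := Nat.eq_of_dvd_of_lt_two_mul (by omega) hdvd (by omega)
  omega

theorem isAhead_apply_iff [Finite X] (heven : Even (minimalPeriod τ u))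
    (huv : τ.SameCycle u v) :
    IsAhead τ u (τ v) ↔ (IsAhead τ u v ∨ u = v) ∧ u ≠ antipode τ v := by
  obtain ⟨j, hj, rfl⟩ := exists_iterate_eq_of_sameCycle huv
  have hhalf := Nat.two_mul_div_two_of_even heven
  have hself : u = τ^[j] u ↔ 0 = j :=
    iterate_eq_iterate_iff_of_lt_minimalPeriod (m := 0) (by omega) hj
  rw [ne_eq, eq_antipode_iterate_iff heven hj, hself, isAhead_iterate_iff hj,
    ← iterate_succ_apply' τ]
  rcases (Nat.succ_le_of_lt hj).eq_or_lt with hlast | hlt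
  · rw [hlast, iterate_minimalPeriod, iff_false_left (not_isAhead_self u)]
    omega
  · rw [isAhead_iterate_iff hlt]
    omega

theorem card_le_card_quotient_sameCycle [Finite X] {Y : Type*} {φ : X → Y}
    (hinv : ∀ x, φ (τ x) = φ x) (hsurj : Surjective φ) :
    Nat.card Y ≤ Nat.card (Quotient (SameCycle.setoid τ)) := by
  have hiter (x : X) (j : ℕ) : φ (τ^[j] x) = φ x := by
    induction j with
    | zero => rfl
    | succ j ih => rw [iterate_succ_apply', hinv, ih]
  have hcycle (x y : X) (h : τ.SameCycle x y) : φ x = φ y := by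
    obtain ⟨j, -, rfl⟩ := exists_iterate_eq_of_sameCycle h
    exact (hiter x j).symm
  exact Nat.card_le_card_of_surjective (Quotient.lift φ hcycle) fun y =>
    (hsurj y).imp' (Quotient.mk _) fun _ => id

end Permutation

section Graph

variable {V W : Type*} {G : SimpleGraph V} {H : SimpleGraph W}

theorem reachable_map_of_adj {f : V → W} (hf : ∀ a b, G.Adj a b → H.Reachable (f a) (f b))
    {a b : V} (h : G.Reachable a b) : H.Reachable (f a) (f b) := by
  rw [SimpleGraph.reachable_iff_reflTransGen] at h ⊢
  exact h.lift' f fun a b hab => (SimpleGraph.reachable_iff_reflTransGen _ _).1 (hf a b hab)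

theorem dist_eq_of_descent {φ : V → ℕ} {a : V} (ha : φ a = 0)
    (hlip : ∀ u v, G.Adj u v → φ v ≤ φ u + 1)
    (hdesc : ∀ b, b ≠ a → ∃ c, G.Adj b c ∧ φ b = φ c + 1) (b : V) : G.dist a b = φ b := by
  have hupper : ∃ p : G.Walk a b, p.length = φ b := by
    induction hk : φ b generalizing b with
    | zero =>
      obtain rfl : b = a := by
        by_contra hb
        obtain ⟨c, -, hc⟩ := hdesc b hb
        omega
      exact ⟨.nil, rfl⟩
    | succ k ih =>
      obtain ⟨c, hbc, hc⟩ := hdesc b (by rintro rfl; omega)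
      obtain ⟨p, rfl⟩ := ih c (by omega)
      exact ⟨p.concat hbc.symm, p.length_concat hbc.symm⟩
  have hlower {u v : V} (p : G.Walk u v) : φ v ≤ φ u + p.length := by
    induction p with
    | nil => rfl
    | cons huv p ih =>
      have := hlip _ _ huv
      rw [SimpleGraph.Walk.length_cons]
      omega
  obtain ⟨p, hp⟩ := hupper
  obtain ⟨q, hq⟩ := p.reachable.exists_walk_length_eq_dist
  have := G.dist_le p
  have := hlower q
  omega

/-- Double counting of the triples of an edge, a vertex outside the cut of that edge and a vertex
inside it. -/
theorem Multigraph.szeged_eq_sum_totalDist_of_cut {V E : Type*} [Fintype V] [DecidableEq V]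
    [Fintype E] {Γ : Multigraph V E} {tail head : E → V} {cut : E → Finset V}
    (hends : ∀ e, Γ.ends e = s(tail e, head e))
    (hclose : ∀ e, Γ.numCloser (tail e) (head e) * Γ.numCloser (head e) (tail e) =
      (cut e)ᶜ.card * (cut e).card)
    (hdist : ∀ a b, Γ.dist a b = (Finset.univ.filter fun e => b ∈ cut e ∧ a ∉ cut e).card) :
    Γ.szeged = ∑ v, Γ.totalDist v := by
  calc Γ.szeged = ∑ e, (cut e)ᶜ.card * (cut e).card := by
        simp only [Multigraph.szeged, hends, Sym2.lift_mk, hclose]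
    _ = ∑ e, ∑ b, ∑ a, if b ∈ cut e ∧ a ∉ cut e then 1 else 0 := by
        refine Finset.sum_congr rfl fun e _ => ?_
        simp only [ite_and, Finset.sum_ite_irrel, Finset.sum_const_zero, Finset.sum_boole,
          Nat.cast_id, Finset.sum_ite_mem, Finset.univ_inter, Finset.sum_const, smul_eq_mul]
        rw [mul_comm, ← Finset.filter_univ_mem (cut e)ᶜ]
        simp only [Finset.mem_compl]
    _ = ∑ b, ∑ a, ∑ e, if b ∈ cut e ∧ a ∉ cut e then 1 else 0 := by
        rw [Finset.sum_comm]
        exact Finset.sum_congr rfl fun b _ => Finset.sum_comm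
    _ = ∑ v, Γ.totalDist v := by
        simp only [Multigraph.totalDist, hdist, Finset.sum_boole, Nat.cast_id]

end Graph

section PermutationFamily

variable {X E : Type*} (σ : E → Equiv.Perm X)

/-- The Schreier graph of a family of permutations: one edge from `u` to `σ e u` for every index
`e` and every point `u`. -/
def permGraph : Multigraph X (E × X) where
  ends p := s(p.2, σ p.1 p.2)

/-- The cycles of the permutations `σ e`, including the fixed points; a cycle carries its index
`e`, so equal subsets that are cycles of different permutations count as different cycles. -/
abbrev LabelledCycle : Type _ := Σ e, Quotient (SameCycle.setoid (σ e))

/-- The cycle of the permutation `σ e` through the point `u`. -/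
def cycleThrough (e : E) (u : X) : LabelledCycle σ := ⟨e, ⟦u⟧⟩

/-- The bipartite incidence graph of the points and the cycles. It is a tree exactly if the
permutations generate a transitive group and their Schreier graph is a cactus formed by the
cycles. -/
def incidenceGraph : SimpleGraph (X ⊕ LabelledCycle σ) :=
  SimpleGraph.fromEdgeSet (Set.range fun p : E × X => s(.inl p.2, .inr (cycleThrough σ p.1 p.2)))

variable {σ}

theorem cycleThrough_eq_iff {e : E} {u v : X} :
    cycleThrough σ e u = cycleThrough σ e v ↔ (σ e).SameCycle u v := by
  rw [cycleThrough, cycleThrough, Sigma.mk.injEq, heq_eq_eq, Quotient.eq]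
  exact and_iff_right rfl

theorem cycleThrough_apply (e : E) (u : X) : cycleThrough σ e (σ e u) = cycleThrough σ e u :=
  cycleThrough_eq_iff.2 (sameCycle_apply_left.2 (SameCycle.refl _ _))

theorem cycleThrough_antipode (e : E) (u : X) :
    cycleThrough σ e (antipode (σ e) u) = cycleThrough σ e u :=
  cycleThrough_eq_iff.2 (sameCycle_iterate u _).symm

theorem exists_cycleThrough_eq (O : LabelledCycle σ) : ∃ u, cycleThrough σ O.1 u = O := by
  obtain ⟨e, O⟩ := O
  induction O using Quotient.inductionOn with | _ u => exact ⟨u, rfl⟩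

theorem permGraph_adj {u v : X} :
    (permGraph σ).simplify.Adj u v ↔ u ≠ v ∧ ∃ e, σ e u = v ∨ σ e v = u := by
  refine and_congr_right fun _ => ⟨?_, ?_⟩
  · rintro ⟨⟨e, w⟩, hw⟩
    rcases Sym2.eq_iff.1 hw with ⟨rfl, rfl⟩ | ⟨rfl, rfl⟩
    · exact ⟨e, Or.inl rfl⟩
    · exact ⟨e, Or.inr rfl⟩
  · rintro ⟨e, rfl | rfl⟩
    · exact ⟨(e, u), rfl⟩
    · exact ⟨(e, v), Sym2.eq_swap⟩

theorem exists_cycleThrough_eq_of_adj {u v : X} (h : (permGraph σ).simplify.Adj u v) :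
    ∃ e, cycleThrough σ e u = cycleThrough σ e v := by
  obtain ⟨-, e, rfl | rfl⟩ := permGraph_adj.1 h
  · exact ⟨e, (cycleThrough_apply e u).symm⟩
  · exact ⟨e, cycleThrough_apply e v⟩

theorem permGraph_cycle_induction (hconn : (permGraph σ).Connected) {P : X → Prop} {a : X}
    (ha : P a) (hstep : ∀ e u v, cycleThrough σ e u = cycleThrough σ e v → P u → P v) (b : X) :
    P b := by
  have hab := (SimpleGraph.reachable_iff_reflTransGen _ _).1 (hconn.preconnected a b)
  induction hab with
  | refl => exact ha
  | tail _ hadj ih =>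
    obtain ⟨e, he⟩ := exists_cycleThrough_eq_of_adj hadj
    exact hstep e _ _ he ih

theorem incidenceGraph_adj {u : X} {O : LabelledCycle σ} :
    (incidenceGraph σ).Adj (.inl u) (.inr O) ↔ cycleThrough σ O.1 u = O := by
  simp only [incidenceGraph, SimpleGraph.fromEdgeSet_adj, Set.mem_range, Prod.exists, Sym2.eq_iff,
    Sum.inl.injEq, Sum.inr.injEq, reduceCtorEq, and_false, or_false, ne_eq, not_false_eq_true,
    and_true]
  constructor
  · rintro ⟨e, v, rfl, rfl⟩
    rfl
  · exact fun h => ⟨O.1, u, rfl, h⟩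

theorem incidenceGraph_connected (hconn : (permGraph σ).Connected) :
    (incidenceGraph σ).Connected := by
  obtain ⟨a⟩ := hconn.nonempty
  have hadj (e : E) (u : X) : (incidenceGraph σ).Adj (.inl u) (.inr (cycleThrough σ e u)) :=
    incidenceGraph_adj.2 rfl
  have hpoint (u : X) : (incidenceGraph σ).Reachable (.inl a) (.inl u) := by
    refine reachable_map_of_adj (fun u v huv => ?_) (hconn.preconnected a u)
    obtain ⟨e, he⟩ := exists_cycleThrough_eq_of_adj huv
    exact (hadj e u).reachable.trans (he ▸ (hadj e v).reachable.symm)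
  refine (SimpleGraph.connected_iff_exists_forall_reachable _).2 ⟨.inl a, ?_⟩
  rintro (u | O)
  · exact hpoint u
  · obtain ⟨u, hu⟩ := exists_cycleThrough_eq O
    exact (hpoint u).trans (hu ▸ (hadj O.1 u).reachable)

/-- A connected graph with fewer edges than vertices is a tree, and the incidence graph has
`|E| * |X|` edges. -/
theorem incidenceGraph_isTree [Finite X] [Fintype E] (hconn : (permGraph σ).Connected)
    (hcard : Fintype.card E * Nat.card X <
      Nat.card X + ∑ e, Nat.card (Quotient (SameCycle.setoid (σ e)))) :
    (incidenceGraph σ).IsTree := by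
  have hT := incidenceGraph_connected hconn
  refine SimpleGraph.isTree_iff_connected_and_card.2
    ⟨hT, le_antisymm ?_ hT.card_vert_le_card_edgeSet_add_one⟩
  have hedges : Nat.card (incidenceGraph σ).edgeSet ≤ Fintype.card E * Nat.card X := by
    rw [← Nat.card_eq_fintype_card, ← Nat.card_prod, incidenceGraph,
      SimpleGraph.edgeSet_fromEdgeSet]
    exact (Nat.card_mono (Set.finite_range _) Set.sdiff_subset).trans (Finite.card_range_le _)
  rw [Nat.card_sum, Nat.card_sigma]
  omega

/-- `g O a` is the gate of the point `a` in the cycle `O`, that is, the point of `O` from which one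
leaves `O` in order to reach `a`. Moving `a` along another cycle does not change it. -/
structure IsCycleGate (σ : E → Equiv.Perm X) (g : LabelledCycle σ → X → X) : Prop where
  cycleThrough_gate : ∀ O a, cycleThrough σ O.1 (g O a) = O
  gate_self : ∀ e u, g (cycleThrough σ e u) u = u
  gate_congr : ∀ {O f b c}, cycleThrough σ f b = cycleThrough σ f c → cycleThrough σ f b ≠ O →
    g O b = g O c

theorem eq_of_reachable_deleteIncidenceSet (hT : (incidenceGraph σ).IsAcyclic)
    {O : LabelledCycle σ} {u v : X} (hu : cycleThrough σ O.1 u = O) (hv : cycleThrough σ O.1 v = O)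
    (huv : ((incidenceGraph σ).deleteIncidenceSet (.inr O)).Reachable (.inl u) (.inl v)) :
    u = v := by
  by_contra hne
  have hbridge := SimpleGraph.isAcyclic_iff_forall_adj_isBridge.1 hT (incidenceGraph_adj.2 hu)
  refine SimpleGraph.isBridge_iff.1 hbridge ?_
  have hle : (incidenceGraph σ).deleteIncidenceSet (.inr O) ≤
      (incidenceGraph σ).deleteEdges {s(.inl u, .inr O)} := by
    refine SimpleGraph.deleteEdges_anti (Set.singleton_subset_iff.2 ?_)
    exact ⟨incidenceGraph_adj.2 hu, Sym2.mem_mk_right _ _⟩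
  refine (huv.mono hle).trans (SimpleGraph.Adj.reachable ?_)
  rw [SimpleGraph.deleteEdges_adj]
  exact ⟨incidenceGraph_adj.2 hv, by simpa using Ne.symm hne⟩

theorem reachable_deleteIncidenceSet {O : LabelledCycle σ} {f : E} {b c : X}
    (hbc : cycleThrough σ f b = cycleThrough σ f c) (hO : cycleThrough σ f b ≠ O) :
    ((incidenceGraph σ).deleteIncidenceSet (.inr O)).Reachable (.inl b) (.inl c) := by
  have hadj (d : X) (hd : cycleThrough σ f d ≠ O) :
      ((incidenceGraph σ).deleteIncidenceSet (.inr O)).Adj (.inl d) (.inr (cycleThrough σ f d)) :=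
    SimpleGraph.deleteIncidenceSet_adj.2
      ⟨incidenceGraph_adj.2 rfl, Sum.inl_ne_inr, Sum.inr_injective.ne hd⟩
  exact (hadj b hO).reachable.trans (hbc ▸ (hadj c (hbc ▸ hO)).reachable.symm)

theorem exists_reachable_deleteIncidenceSet (hconn : (permGraph σ).Connected)
    (O : LabelledCycle σ) (a : X) :
    ∃ v, cycleThrough σ O.1 v = O ∧
      ((incidenceGraph σ).deleteIncidenceSet (.inr O)).Reachable (.inl a) (.inl v) := by
  obtain ⟨u, hu⟩ := exists_cycleThrough_eq O
  refine permGraph_cycle_induction hconn (P := fun a => ∃ v, cycleThrough σ O.1 v = O ∧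
    ((incidenceGraph σ).deleteIncidenceSet (.inr O)).Reachable (.inl a) (.inl v))
    ⟨u, hu, .refl _⟩ ?_ a
  rintro f b c hbc ⟨v, hv, hbv⟩
  by_cases hO : cycleThrough σ f b = O
  · exact ⟨c, by rw [← hO, hbc]; rfl, .refl _⟩
  · exact ⟨v, hv, (reachable_deleteIncidenceSet hbc hO).symm.trans hbv⟩

theorem exists_isCycleGate (hconn : (permGraph σ).Connected)
    (hT : (incidenceGraph σ).IsAcyclic) : ∃ g, IsCycleGate σ g := by
  choose g hmem hreach using exists_reachable_deleteIncidenceSet hconn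
  refine ⟨g, hmem, fun e u => ?_, fun {O f b c} hbc hO => ?_⟩
  · exact (eq_of_reachable_deleteIncidenceSet hT rfl (hmem _ _) (hreach _ u)).symm
  · refine eq_of_reachable_deleteIncidenceSet hT (hmem O b) (hmem O c) ?_
    exact ((hreach O b).symm.trans (reachable_deleteIncidenceSet hbc hO)).trans (hreach O c)

namespace IsCycleGate

variable {g : LabelledCycle σ → X → X}

theorem gate_of_mem (h : IsCycleGate σ g) {e : E} {u a : X}
    (ha : cycleThrough σ e u = cycleThrough σ e a) : g (cycleThrough σ e u) a = a := by
  rw [ha, h.gate_self]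

theorem sameCycle_gate (h : IsCycleGate σ g) (e : E) (u a : X) :
    (σ e).SameCycle u (g (cycleThrough σ e u) a) :=
  cycleThrough_eq_iff.1 (h.cycleThrough_gate (cycleThrough σ e u) a).symm

theorem exists_gate_ne (h : IsCycleGate σ g) (hconn : (permGraph σ).Connected) {a b : X}
    (hab : a ≠ b) : ∃ f, g (cycleThrough σ f b) a ≠ b := by
  refine permGraph_cycle_induction hconn
    (P := fun a => a ≠ b → ∃ f, g (cycleThrough σ f b) a ≠ b) (absurd rfl) ?_ a hab
  intro e u v huv ih hv
  by_cases hub : u = b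
  · subst hub
    exact ⟨e, by rwa [h.gate_of_mem huv]⟩
  · obtain ⟨f, hf⟩ := ih hub
    refine ⟨f, ?_⟩
    by_cases hmem : cycleThrough σ e u = cycleThrough σ f b
    · obtain rfl : e = f := congrArg Sigma.fst hmem
      rwa [h.gate_of_mem (hmem.symm.trans huv)]
    · rwa [← h.gate_congr huv hmem]

variable [Fintype X]

open Classical in
/-- The points beyond the edge from `u` to `σ e u`, where `p = (e, u)`: those whose gate in the
cycle of this edge is closer to `σ e u` than to `u` along the cycle. -/
noncomputable def farSide (g : LabelledCycle σ → X → X) (p : E × X) : Finset X :=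
  {a | IsAhead (σ p.1) p.2 (g (cycleThrough σ p.1 p.2) a)}

theorem mem_farSide {e : E} {u a : X} :
    a ∈ farSide g (e, u) ↔ IsAhead (σ e) u (g (cycleThrough σ e u) a) := by
  simp [farSide]

theorem start_notMem_farSide (h : IsCycleGate σ g) (e : E) (u : X) : u ∉ farSide g (e, u) := by
  rw [mem_farSide, h.gate_self]
  exact not_isAhead_self u

theorem farSide_eq_empty {e : E} {u : X} (hu : σ e u = u) : farSide g (e, u) = ∅ :=
  Finset.eq_empty_of_forall_notMem fun _ ha => not_isAhead_of_fixed hu (mem_farSide.1 ha)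

theorem mem_farSide_antipode_iff (h : IsCycleGate σ g) {e : E} {u : X}
    (heven : Even (minimalPeriod (σ e) u)) (a : X) :
    a ∈ farSide g (e, antipode (σ e) u) ↔ a ∉ farSide g (e, u) := by
  rw [mem_farSide, mem_farSide, cycleThrough_antipode,
    isAhead_antipode_iff heven (h.sameCycle_gate e u a)]

/-- Traversing the edge from `b` to `σ f b` crosses exactly two cuts: that of the edge itself and
that of the opposite edge of its cycle. -/
theorem apply_mem_farSide_iff (h : IsCycleGate σ g) {f : E} {b : X}
    (heven : Even (minimalPeriod (σ f) b)) (p : E × X) :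
    σ f b ∈ farSide g p ↔ (b ∈ farSide g p ∨ p = (f, b)) ∧ p ≠ (f, antipode (σ f) b) := by
  obtain ⟨e, u⟩ := p
  by_cases hmem : cycleThrough σ e u = cycleThrough σ f b
  · obtain rfl : e = f := congrArg Sigma.fst hmem
    have hub := cycleThrough_eq_iff.1 hmem
    have hperiod : minimalPeriod (σ e) u = minimalPeriod (σ e) b := by
      obtain ⟨j, -, rfl⟩ := exists_iterate_eq_of_sameCycle hub
      exact (minimalPeriod_iterate_perm u j).symm
    rw [mem_farSide, mem_farSide, h.gate_of_mem hmem,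
      h.gate_of_mem (hmem.trans (cycleThrough_apply e b).symm),
      isAhead_apply_iff (hperiod ▸ heven) hub, Prod.mk_right_inj, ne_eq, ne_eq, Prod.mk_right_inj]
  · have hne {v : X} (hv : cycleThrough σ f v = cycleThrough σ f b) : (e, u) ≠ (f, v) := by
      rintro ⟨⟩
      exact hmem hv
    rw [mem_farSide, mem_farSide, h.gate_congr (cycleThrough_apply f b)
      (by rw [cycleThrough_apply]; exact Ne.symm hmem)]
    simp only [hne rfl, hne (cycleThrough_antipode f b), or_false, ne_eq, not_false_eq_true,
      and_true]

variable [Fintype E]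

open Classical in
/-- The number of edges which have `b`, but not `a`, on their far side. -/
noncomputable def cutDist (g : LabelledCycle σ → X → X) (a b : X) : ℕ :=
  Finset.card {p : E × X | b ∈ farSide g p ∧ a ∉ farSide g p}

theorem cutDist_self (a : X) : cutDist g a a = 0 := by simp [cutDist]

theorem cutDist_apply_of_notMem (h : IsCycleGate σ g) {f : E} {a b : X}
    (heven : Even (minimalPeriod (σ f) b)) (ha : a ∉ farSide g (f, b)) :
    cutDist g a (σ f b) = cutDist g a b + 1 := by
  classical
  have hb := h.start_notMem_farSide f b
  have hant := (h.mem_farSide_antipode_iff heven a).2 ha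
  rw [cutDist, cutDist, ← Finset.card_insert_of_notMem (a := (f, b)) (by simp [hb])]
  congr 1
  ext p
  have := h.apply_mem_farSide_iff heven p
  simp only [Finset.mem_insert, Finset.mem_filter, Finset.mem_univ, true_and]
  grind

theorem cutDist_apply_of_mem (h : IsCycleGate σ g) {f : E} {a b : X}
    (heven : Even (minimalPeriod (σ f) b)) (ha : a ∈ farSide g (f, b)) :
    cutDist g a b = cutDist g a (σ f b) + 1 := by
  classical
  have hb := (h.mem_farSide_antipode_iff heven b).2 (h.start_notMem_farSide f b)
  have hant : a ∉ farSide g (f, antipode (σ f) b) := fun hmem =>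
    (h.mem_farSide_antipode_iff heven a).1 hmem ha
  have hb' : σ f b ∉ farSide g (f, antipode (σ f) b) := fun hmem =>
    ((h.apply_mem_farSide_iff heven _).1 hmem).2 rfl
  rw [cutDist, cutDist,
    ← Finset.card_insert_of_notMem (a := (f, antipode (σ f) b)) (by simp [hb'])]
  congr 1
  ext p
  have := h.apply_mem_farSide_iff heven p
  simp only [Finset.mem_insert, Finset.mem_filter, Finset.mem_univ, true_and]
  grind

variable (heven : ∀ e u, σ e u ≠ u → Even (minimalPeriod (σ e) u))
include heven

theorem cutDist_le_of_adj (h : IsCycleGate σ g) {u v : X} (huv : (permGraph σ).simplify.Adj u v)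
    (a : X) : cutDist g a v ≤ cutDist g a u + 1 := by
  obtain ⟨hne, e, rfl | rfl⟩ := permGraph_adj.1 huv
  · by_cases ha : a ∈ farSide g (e, u)
    · have := h.cutDist_apply_of_mem (heven e u hne.symm) ha
      omega
    · exact (h.cutDist_apply_of_notMem (heven e u hne.symm) ha).le
  · by_cases ha : a ∈ farSide g (e, v)
    · exact (h.cutDist_apply_of_mem (heven e v hne) ha).le
    · have := h.cutDist_apply_of_notMem (heven e v hne) ha
      omega

/-- If the gate `w` of `a` in a cycle through `b` differs from `b`, then one of the two steps from
`b` along this cycle leads towards `w`. -/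
theorem exists_adj_cutDist (h : IsCycleGate σ g) (hconn : (permGraph σ).Connected) {a b : X}
    (hba : b ≠ a) :
    ∃ c, (permGraph σ).simplify.Adj b c ∧ cutDist g a b = cutDist g a c + 1 := by
  obtain ⟨f, hgate⟩ := h.exists_gate_ne hconn hba.symm
  have hfb : σ f b ≠ b := fun hfix => hgate <| by
    obtain ⟨j, -, hj⟩ := exists_iterate_eq_of_sameCycle (h.sameCycle_gate f b a)
    rw [← hj, iterate_fixed hfix]
  by_cases ha : a ∈ farSide g (f, b)
  · exact ⟨σ f b, permGraph_adj.2 ⟨hfb.symm, f, Or.inl rfl⟩,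
      h.cutDist_apply_of_mem (heven f b hfb) ha⟩
  · obtain ⟨d, rfl⟩ := (σ f).surjective b
    have hd : σ f d ≠ d := fun hd => hfb (congrArg (σ f) hd)
    refine ⟨d, permGraph_adj.2 ⟨hd, f, Or.inr rfl⟩,
      h.cutDist_apply_of_notMem (heven f d hd) fun had => ha ?_⟩
    rw [cycleThrough_apply] at hgate
    rw [mem_farSide, cycleThrough_apply]
    exact (mem_farSide.1 had).of_apply_ne hgate.symm

theorem dist_eq_cutDist (h : IsCycleGate σ g) (hconn : (permGraph σ).Connected) (a b : X) :
    (permGraph σ).dist a b = cutDist g a b :=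
  dist_eq_of_descent (cutDist_self a) (fun _ _ huv => h.cutDist_le_of_adj heven huv a)
    (fun _ hba => h.exists_adj_cutDist heven hconn hba) b

omit [Fintype E] in
theorem numCloser_mul_numCloser [Finite E] [DecidableEq X] (h : IsCycleGate σ g)
    (hconn : (permGraph σ).Connected) (e : E) (u : X) :
    (permGraph σ).numCloser u (σ e u) * (permGraph σ).numCloser (σ e u) u =
      (farSide g (e, u))ᶜ.card * (farSide g (e, u)).card := by
  cases nonempty_fintype E
  by_cases hu : σ e u = u
  · simp [hu, Multigraph.numCloser, farSide_eq_empty hu]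
  · have hforward (a : X) := h.cutDist_apply_of_mem (a := a) (heven e u hu)
    have hbackward (a : X) := h.cutDist_apply_of_notMem (a := a) (heven e u hu)
    simp only [Multigraph.numCloser, h.dist_eq_cutDist heven hconn]
    congr 2 <;> ext a <;> simp only [Finset.mem_filter, Finset.mem_univ, true_and,
      Finset.mem_compl] <;> grind

end IsCycleGate

/-- By `incidenceGraph_isTree` the inequality `hcard` expresses that the cycles form a cactus. -/
theorem szeged_permGraph_eq_sum_totalDist [Fintype X] [Fintype E]
    (hconn : (permGraph σ).Connected)
    (hcard : Fintype.card E * Nat.card X <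
      Nat.card X + ∑ e, Nat.card (Quotient (SameCycle.setoid (σ e))))
    (heven : ∀ e u, σ e u ≠ u → Even (minimalPeriod (σ e) u)) :
    (permGraph σ).szeged = ∑ v, (permGraph σ).totalDist v := by
  classical
  obtain ⟨g, hg⟩ := exists_isCycleGate hconn (incidenceGraph_isTree hconn hcard).isAcyclic
  refine Multigraph.szeged_eq_sum_totalDist_of_cut (tail := Prod.snd)
    (head := fun p => σ p.1 p.2) (cut := IsCycleGate.farSide g) (fun _ => rfl)
    (fun p => hg.numCloser_mul_numCloser heven hconn p.1 p.2) fun a b => ?_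
  rw [hg.dist_eq_cutDist heven hconn, IsCycleGate.cutDist]

end PermutationFamily

section Automaton

theorem Transducer.act_cons {Q X : Type*} (A : Transducer Q X) (q : Q) (z : X) {n : ℕ}
    (w : Fin n → X) :
    A.act q (Fin.cons z w : Fin (n + 1) → X) = Fin.cons (A.out q z) (A.act (A.restr q z) w) := by
  simp only [Transducer.act, Fin.cons_zero, Fin.tail_cons]

theorem Transducer.act_injective {Q X : Type*} {A : Transducer Q X}
    (hA : ∀ q, Injective (A.out q)) (n : ℕ) (q : Q) :
    Injective (A.act q : (Fin n → X) → Fin n → X) := by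
  induction n generalizing q with
  | zero => exact injective_of_subsingleton _
  | succ n ih =>
    intro u v huv
    induction u using Fin.consCases with | _ y u
    induction v using Fin.consCases with | _ z v
    rw [A.act_cons, A.act_cons, Fin.cons_inj] at huv
    obtain rfl := hA q huv.1
    rw [ih _ huv.2]

variable {V : Type*} {G : SimpleGraph V} (o : G.EdgeOrientation)

theorem adj_source_target (e : G.edgeSet) : G.Adj (o.source e) (o.target e) := by
  rw [← SimpleGraph.mem_edgeSet, o.ends_eq]
  exact e.2

theorem exists_source_target_of_adj {a b : V} (h : G.Adj a b) :
    ∃ e, (o.source e = a ∧ o.target e = b) ∨ (o.source e = b ∧ o.target e = a) :=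
  ⟨⟨s(a, b), h⟩, Sym2.eq_iff.1 (o.ends_eq ⟨s(a, b), h⟩)⟩

variable [DecidableEq V]

theorem automaton_out_some (e : G.edgeSet) :
    o.automaton.out (some e) = Equiv.swap (o.source e) (o.target e) := by
  funext z
  rw [Equiv.swap_apply_def]
  rfl

theorem automaton_out_injective (q : Option G.edgeSet) : Injective (o.automaton.out q) := by
  cases q with
  | none => exact injective_id
  | some e =>
    rw [automaton_out_some]
    exact Equiv.injective _

theorem act_none {n : ℕ} (w : Fin n → V) : o.automaton.act none w = w := by
  induction n with
  | zero => rfl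
  | succ n ih =>
    induction w using Fin.consCases with | _ z w
    exact (Transducer.act_cons _ _ z w).trans (congrArg (Fin.cons (α := fun _ => V) z) (ih w))

theorem act_source (e : G.edgeSet) {n : ℕ} (w : Fin n → V) :
    o.automaton.act (some e) (Fin.cons (o.source e) w : Fin (n + 1) → V) =
      Fin.cons (o.target e) (o.automaton.act (some e) w) := by
  have hrestr : o.automaton.restr (some e) (o.source e) = some e := if_pos rfl
  rw [Transducer.act_cons, automaton_out_some, hrestr, Equiv.swap_apply_left]

theorem act_of_ne_source {e : G.edgeSet} {z : V} (hz : z ≠ o.source e) {n : ℕ} (w : Fin n → V) :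
    o.automaton.act (some e) (Fin.cons z w : Fin (n + 1) → V) =
      Fin.cons (Equiv.swap (o.source e) (o.target e) z) w := by
  have hrestr : o.automaton.restr (some e) z = none := if_neg hz
  rw [Transducer.act_cons, automaton_out_some, hrestr, act_none]

theorem act_target (e : G.edgeSet) {n : ℕ} (w : Fin n → V) :
    o.automaton.act (some e) (Fin.cons (o.target e) w : Fin (n + 1) → V) =
      Fin.cons (o.source e) w := by
  rw [act_of_ne_source o (adj_source_target o e).ne', Equiv.swap_apply_right]

/-- The permutation of the words of length `n` given by a state of the automaton. -/
noncomputable def statePerm [Finite V] (n : ℕ) (q : Option G.edgeSet) : Equiv.Perm (Fin n → V) :=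
  Equiv.ofBijective (o.automaton.act q) <|
    Finite.injective_iff_bijective.1 (Transducer.act_injective (automaton_out_injective o) n q)

theorem schreierGraph_eq_permGraph [Finite V] (n : ℕ) :
    o.automaton.schreierGraph n = permGraph (statePerm o n) := rfl

theorem reachable_act (q : Option G.edgeSet) {n : ℕ} (u : Fin n → V) :
    (o.automaton.schreierGraph n).simplify.Reachable u (o.automaton.act q u) := by
  by_cases h : u = o.automaton.act q u
  · rw [← h]
  · exact SimpleGraph.Adj.reachable ⟨h, (q, u), rfl⟩

theorem reachable_cons_of_adj {a b : V} (hab : G.Adj a b) {n : ℕ} (w : Fin n → V) :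
    (o.automaton.schreierGraph (n + 1)).simplify.Reachable (Fin.cons a w) (Fin.cons b w) := by
  obtain ⟨e, ⟨rfl, rfl⟩ | ⟨rfl, rfl⟩⟩ := exists_source_target_of_adj o hab
  · exact act_target o e w ▸ (reachable_act o (some e) (Fin.cons (o.target e) w)).symm
  · exact act_target o e w ▸ reachable_act o (some e) (Fin.cons (o.target e) w)

theorem reachable_cons_act (hG : G.Preconnected) (c : V) (q : Option G.edgeSet) {n : ℕ}
    (u : Fin n → V) :
    (o.automaton.schreierGraph (n + 1)).simplify.Reachable (Fin.cons c u)
      (Fin.cons c (o.automaton.act q u)) := by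
  have hletter (a b : V) (w : Fin n → V) := reachable_map_of_adj
    (fun _ _ hab => reachable_cons_of_adj o hab w) (hG a b)
  cases q with
  | none => rw [act_none]
  | some e =>
    refine (hletter c (o.source e) u).trans (.trans ?_ (hletter (o.target e) c _))
    exact act_source o e u ▸ reachable_act o (some e) (Fin.cons (o.source e) u)

theorem schreierGraph_preconnected (hG : G.Preconnected) (n : ℕ) :
    (o.automaton.schreierGraph n).simplify.Preconnected := by
  induction n with
  | zero => exact fun u v => Subsingleton.elim u v ▸ .refl _
  | succ n ih =>
    intro u v
    induction u using Fin.consCases with | _ a u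
    induction v using Fin.consCases with | _ b v
    refine (reachable_map_of_adj (f := fun c => (Fin.cons c u : Fin (n + 1) → V))
      (fun _ _ hab => reachable_cons_of_adj o hab u) (hG a b)).trans ?_
    refine reachable_map_of_adj (f := fun w => (Fin.cons b w : Fin (n + 1) → V)) ?_ (ih u v)
    rintro w w' ⟨-, ⟨q, x⟩, hx⟩
    have hreach := reachable_cons_act o hG b q x
    rcases Sym2.eq_iff.1 hx with ⟨rfl, rfl⟩ | ⟨rfl, rfl⟩
    exacts [hreach, hreach.symm]

theorem schreierGraph_connected (hG : G.Connected) (n : ℕ) :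
    (o.automaton.schreierGraph n).Connected := by
  have := hG.nonempty
  exact ⟨schreierGraph_preconnected o hG.preconnected n⟩

variable [Finite V]

theorem statePerm_none (n : ℕ) : statePerm o n none = 1 :=
  Equiv.ext fun w => act_none o w

theorem statePerm_source (e : G.edgeSet) {n : ℕ} (w : Fin n → V) :
    statePerm o (n + 1) (some e) (Fin.cons (o.source e) w) =
      Fin.cons (o.target e) (statePerm o n (some e) w) :=
  act_source o e w

theorem statePerm_target (e : G.edgeSet) {n : ℕ} (w : Fin n → V) :
    statePerm o (n + 1) (some e) (Fin.cons (o.target e) w) = Fin.cons (o.source e) w :=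
  act_target o e w

theorem statePerm_of_ne {e : G.edgeSet} {z : V} (hs : z ≠ o.source e) (ht : z ≠ o.target e)
    {n : ℕ} (w : Fin n → V) :
    statePerm o (n + 1) (some e) (Fin.cons z w) = Fin.cons z w :=
  (act_of_ne_source o hs w).trans (by rw [Equiv.swap_apply_of_ne_of_ne hs ht])

/-- A state that moves a word toggles its first letter between the two ends of its edge. -/
theorem even_minimalPeriod_statePerm {n : ℕ} {q : Option G.edgeSet} {u : Fin n → V}
    (hu : statePerm o n q u ≠ u) : Even (minimalPeriod (statePerm o n q) u) := by
  cases n with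
  | zero => exact absurd (Subsingleton.elim _ _) hu
  | succ n =>
    cases q with
    | none => exact absurd (by rw [statePerm_none]; rfl) hu
    | some e =>
      refine even_minimalPeriod_of_flip (Equiv.injective _) (P := fun v => v 0 = o.source e)
        (fun v hv => ?_) hu
      have hne := (adj_source_target o e).ne'
      induction v using Fin.consCases with | _ z w
      by_cases hs : z = o.source e
      · simp [hs, statePerm_source, hne]
      by_cases ht : z = o.target e
      · simp [ht, statePerm_target, hne]
      · exact absurd (statePerm_of_ne o hs ht w) hv

/-- The words whose first letter is not an end of `e` are fixed by `e`; the cycles of the other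
words are obtained from the cycles in length `n` by doubling. -/
theorem le_card_quotient_sameCycle_statePerm_succ (e : G.edgeSet) (n : ℕ) :
    Nat.card V * Nat.card (Fin n → V) +
        Nat.card (Quotient (SameCycle.setoid (statePerm o n (some e)))) ≤
      Nat.card (Quotient (SameCycle.setoid (statePerm o (n + 1) (some e)))) +
        2 * Nat.card (Fin n → V) := by
  let ends : Set V := {o.source e, o.target e}
  let φ (v : Fin (n + 1) → V) :
      (↥endsᶜ × (Fin n → V)) ⊕ Quotient (SameCycle.setoid (statePerm o n (some e))) :=
    if hv : v 0 ∈ endsᶜ then .inl (⟨v 0, hv⟩, Fin.tail v) else .inr ⟦Fin.tail v⟧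
  have hφ_end {z : V} (hz : z ∈ ends) (w : Fin n → V) : φ (Fin.cons z w) = .inr ⟦w⟧ :=
    dif_neg (not_not.2 hz)
  have hφ_inner {z : V} (hz : z ∈ endsᶜ) (w : Fin n → V) :
      φ (Fin.cons z w) = .inl (⟨z, hz⟩, w) := dif_pos hz
  have hinv (v : Fin (n + 1) → V) : φ (statePerm o (n + 1) (some e) v) = φ v := by
    induction v using Fin.consCases with | _ z w
    by_cases hz : z ∈ ends
    · rcases hz with rfl | rfl
      · rw [statePerm_source, hφ_end (.inr rfl), hφ_end (.inl rfl)]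
        exact congrArg _ (Quotient.sound (sameCycle_apply_left.2 (SameCycle.refl _ _)))
      · rw [statePerm_target, hφ_end (.inr rfl), hφ_end (.inl rfl)]
    · rw [statePerm_of_ne o (fun h => hz (.inl h)) fun h => hz (.inr h)]
  have hsurj : Surjective φ := by
    rintro (⟨z, w⟩ | O)
    · exact ⟨_, hφ_inner z.2 w⟩
    · induction O using Quotient.inductionOn with | _ w
      exact ⟨_, hφ_end (.inl rfl) w⟩
  have hcard := card_le_card_quotient_sameCycle hinv hsurj
  have hends : ends.ncard + Nat.card ↥endsᶜ = Nat.card V := Set.ncard_add_ncard_compl ends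
  rw [Set.ncard_pair (adj_source_target o e).ne] at hends
  rw [Nat.card_sum, Nat.card_prod] at hcard
  rw [← hends, add_mul]
  omega

theorem card_edgeSet_mul_lt_sum_card_quotient_sameCycle [Fintype G.edgeSet] (hG : G.IsTree)
    (n : ℕ) :
    Fintype.card G.edgeSet * Nat.card (Fin n → V) <
      Nat.card (Fin n → V) +
        ∑ e : G.edgeSet, Nat.card (Quotient (SameCycle.setoid (statePerm o n (some e)))) := by
  have hV : Nat.card V = Fintype.card G.edgeSet + 1 := by
    rw [← Nat.card_eq_fintype_card]
    exact (SimpleGraph.isTree_iff_connected_and_card.1 hG).2.symm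
  induction n with
  | zero => simp
  | succ n ih =>
    have hsum := Finset.sum_le_sum fun (e : G.edgeSet) (_ : e ∈ Finset.univ) =>
      le_card_quotient_sameCycle_statePerm_succ o e n
    simp only [Finset.sum_add_distrib, Finset.sum_const, Finset.card_univ, smul_eq_mul] at hsum
    have hword : Nat.card (Fin (n + 1) → V) = Nat.card V * Nat.card (Fin n → V) := by
      rw [Nat.card_fun, Nat.card_fun, Nat.card_fin, Nat.card_fin, pow_succ']
    rw [hV] at hword hsum
    rw [hword]
    linarith

theorem card_option_mul_lt_sum_card_quotient_sameCycle [Fintype G.edgeSet] (hG : G.IsTree)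
    (n : ℕ) :
    Fintype.card (Option G.edgeSet) * Nat.card (Fin n → V) <
      Nat.card (Fin n → V) + ∑ q, Nat.card (Quotient (SameCycle.setoid (statePerm o n q))) := by
  have hnone : Nat.card (Fin n → V) ≤
      Nat.card (Quotient (SameCycle.setoid (statePerm o n none))) :=
    card_le_card_quotient_sameCycle (φ := id) (fun w => by rw [statePerm_none]; rfl) surjective_id
  have hsome := card_edgeSet_mul_lt_sum_card_quotient_sameCycle o hG n
  rw [Fintype.sum_option, Fintype.card_option, add_one_mul]
  omega

end Automaton

theorem mainTheorem9 {V : Type*} [Fintype V] [DecidableEq V] (G : SimpleGraph V)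
    [DecidableRel G.Adj] (hG : G.IsTree) (o : G.EdgeOrientation) (n : ℕ) :
    (o.automaton.schreierGraph n).Connected ∧
      ((o.automaton.schreierGraph n).szeged : ℚ) = 2 * (o.automaton.schreierGraph n).wiener := by
  have hconn := schreierGraph_connected o hG.connected n
  rw [schreierGraph_eq_permGraph] at hconn ⊢
  have hszeged := szeged_permGraph_eq_sum_totalDist hconn
    (card_option_mul_lt_sum_card_quotient_sameCycle o hG n)
    fun _ _ => even_minimalPeriod_statePerm o
  refine ⟨hconn, ?_⟩
  rw [Multigraph.wiener, hszeged]
  push_cast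
  ring
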